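/- Let $d\ge 2$, $V=\{x\in\mathbb R^d:\sum_i x_i=0\}$ (a Euclidean space, identified with $\mathbb R^{d-1}$), let $l_i(v)$ be the $i$-th coordinate of $v\in V$ and $G(v)=\log\big(\tfrac1d\sum_{i=1}^d e^{l_i(v)}\big)$. Let $\mathcal P$ be a Poisson point process on $V\times\mathbb R$ with intensity measure $\sqrt d\,e^{dh}\,dh\,dv$. For $w\in V\times\mathbb R$ let $\Pi^{\downarrow}(w)=w+\{(v,h):h\le -G(v)\}$ and $\Pi^{\uparrow}(w)=w+\{(v,h):h\ge G(-v)\}$. For $\lambda\ge 1$ put $\delta_0=\exp(-(\log\lambda)^{1/d})$, $$W_\lambda=\{(v,h)\in V\times\mathbb R: h\le -l_i(v)+\log(\lambda^{1/d}\delta_0),\ 1\le i\le d\},\qquad \mathcal P^{(\lambda)}=\mathcal P\cap W_\lambda,$$ and $W_\infty=V\times\mathbb R$, $\mathcal P^{(\infty)}=\mathcal P$. For $1\le\lambda\le\infty$ let $$\Psi(\mathcal P^{(\lambda)})=\bigcup_{w\in\mathcal P^{(\lambda)}}\Pi^{\uparrow}(w)\cap W_\lambda,\qquad \Phi(\mathcal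 P^{(\lambda)})=\bigcup_{w\in V\times\mathbb R:\ \mathcal P^{(\lambda)}\cap\operatorname{int}\Pi^{\downarrow}(w)=\emptyset}\Pi^{\downarrow}(w)\cap W_\lambda,$$ and let $\partial\Psi(\mathcal P^{(\lambda)})$, $\partial\Phi(\mathcal P^{(\lambda)})$ be their topological boundaries in the space $W_\lambda$ (for $\lambda=\infty$, in $V\times\mathbb R$). Fix $L\in(0,\infty)$ and let $B_{d-1}(\mathbf 0,L)$ be the closed ball of radius $L$ around the origin of $V$. Then $\partial\Psi(\mathcal P^{(\lambda)})$ converges in probability to $\partial\Psi(\mathcal P)$ in $\mathcal C(B_{d-1}(\mathbf 0,L))$ with the supremum norm as $\lambda\to\infty$, and likewise $\partial\Phi(\mathcal P^{(\lambda)})$ converges in probability to $\partial\Phi(\mathcal P)$. Here a boundary is seen as the continuous function on $B_{d-1}(\mathbf 0,L)$ of which it is the graph over $B_{d-1}(\mathbf 0,L)$. It is part of the claim that the two limits are such graphs almost surely, and the boundaries for finite $\lambda$ with probability tending to $1$ as $\lambda\to\infty$; where this fails, the function is set to $0$. -/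

import Mathlib

open MeasureTheory ProbabilityTheory Set Filter Topology

namespace GermGrain

noncomputable section

/-- The hyperplane `V = {x ∈ ℝ^d : x_1 + ⋯ + x_d = 0}` of Euclidean space, with the induced inner
product; it plays the role of `ℝ^(d-1)`. -/
abbrev V (d : ℕ) : Submodule ℝ (EuclideanSpace ℝ (Fin d)) where
  carrier := {x | ∑ i, x i = 0}
  add_mem' := by
    intro a b ha hb
    simp only [mem_ofPred_eq] at ha hb ⊢
    simp [Finset.sum_add_distrib, ha, hb]
  zero_mem' := by simp
  smul_mem' := by
    intro c x hx
    simp only [mem_ofPred_eq] at hx ⊢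
    simp [← Finset.mul_sum, hx]

/-- `G(v) = log ((1/d) ∑ exp (l_i(v)))`, where `l_i(v)` is the `i`-th standard coordinate. -/
def G {d : ℕ} (v : V d) : ℝ :=
  Real.log ((1 / (d : ℝ)) * ∑ i, Real.exp ((v : EuclideanSpace ℝ (Fin d)) i))

/-- The down cone-like grain with apex at the origin. -/
def downCone (d : ℕ) : Set (V d × ℝ) := {x | x.2 ≤ -G x.1}

/-- The up cone-like grain with apex at the origin. -/
def upCone (d : ℕ) : Set (V d × ℝ) := {x | G (-x.1) ≤ x.2}

/-- The down grain with apex `w`. -/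
def downGrain {d : ℕ} (w : V d × ℝ) : Set (V d × ℝ) := (fun x => w + x) '' downCone d

/-- The up grain with apex `w`. -/
def upGrain {d : ℕ} (w : V d × ℝ) : Set (V d × ℝ) := (fun x => w + x) '' upCone d

/-- The hull `Φ` of `X` in the window `W`: the union, cut to `W`, of all the down grains (with
arbitrary apex) whose interior contains no point of `X`. -/
def Phi {d : ℕ} (W X : Set (V d × ℝ)) : Set (V d × ℝ) :=
  ⋃ w ∈ {w : V d × ℝ | X ∩ interior (downGrain w) = ∅}, downGrain w ∩ W

/-- The union `Ψ`, cut to the window `W`, of the up grains with apices in `X`. -/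
def Psi {d : ℕ} (W X : Set (V d × ℝ)) : Set (V d × ℝ) :=
  ⋃ w ∈ X, upGrain w ∩ W

/-- `δ₀(λ) = exp (-(log λ)^(1/d))`. -/
def delta0 (d : ℕ) (lam : ℝ) : ℝ := Real.exp (-(Real.log lam) ^ (1 / (d : ℝ)))

/-- The window `W_λ`, the image of the cube `(0, δ₀]^d` under the scaling transform. -/
def window (d : ℕ) (lam : ℝ) : Set (V d × ℝ) :=
  {x | ∀ i, x.2 ≤ -((x.1 : EuclideanSpace ℝ (Fin d)) i)
    + Real.log (lam ^ (1 / (d : ℝ)) * delta0 d lam)}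

/-- The measure with density `√d · exp (d h)` with respect to `dv dh`. -/
def intensity (d : ℕ) : Measure (V d × ℝ) :=
  (volume : Measure (V d × ℝ)).withDensity
    (fun x => ENNReal.ofReal (Real.sqrt d * Real.exp (d * x.2)))

/-- `P` is a (simple) Poisson point process with intensity measure `Λ`: a random locally finite
set whose numbers of points in Borel sets of finite `Λ`-measure are Poisson distributed,
and independent for pairwise disjoint Borel sets. -/
structure IsPoissonProcess {Ω E : Type*} [MeasurableSpace Ω] [TopologicalSpace E]
    [MeasurableSpace E] (μ : Measure Ω) (Λ : Measure E) (P : Ω → Set E) : Prop where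
  locallyFinite : ∀ ω, ∀ K : Set E, IsCompact K → (P ω ∩ K).Finite
  measurable_count : ∀ B : Set E, MeasurableSet B → Measurable fun ω => (P ω ∩ B).encard
  law_count : ∀ B : Set E, MeasurableSet B → Λ B ≠ ⊤ →
    μ.map (fun ω => (P ω ∩ B).encard)
      = (poissonMeasure (Λ B).toNNReal).map (fun n : ℕ => (n : ℕ∞))
  indep_count : ∀ (n : ℕ) (B : Fin n → Set E), (∀ i, MeasurableSet (B i)) →
    Pairwise (fun i j => Disjoint (B i) (B j)) →
    iIndepFun (fun i ω => (P ω ∩ B i).encard) μ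

/-- The topological boundary of `A ∩ W` in the subspace `W`; for `W = univ` it is the usual
boundary of `A`. -/
def boundaryIn {E : Type*} [TopologicalSpace E] (W A : Set E) : Set E :=
  Subtype.val '' frontier (Subtype.val ⁻¹' A : Set W)

/-- Over the closed ball `B(0, L)` of `V`, the set `S` is the graph of the continuous function
`f`. -/
def IsGraphOver {d : ℕ} (L : ℝ) (S : Set (V d × ℝ))
    (f : C(Metric.closedBall (0 : V d) L, ℝ)) : Prop :=
  S ∩ {x | x.1 ∈ Metric.closedBall (0 : V d) L} =
    range fun v : Metric.closedBall (0 : V d) L => ((v : V d), f v)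

open Classical in
/-- The continuous function on `B(0, L)` whose graph is the part of `S` over `B(0, L)`
(and `0` if there is none). -/
def graphFun {d : ℕ} (L : ℝ) (S : Set (V d × ℝ)) : C(Metric.closedBall (0 : V d) L, ℝ) :=
  if h : ∃ f, IsGraphOver L S f then h.choose else 0

/-- Convergence in probability in `C(B(0, L))`, as `λ → ∞`, of the random sets `S λ` to the random
set `S'`, all seen as continuous functions on `B(0, L)`: almost surely `S'` is over `B(0, L)` the
graph of a continuous function, with probability tending to one so is `S λ`, and these functions
converge in probability for the supremum distance. -/
def ConvergesInProbabilityOver {Ω : Type*} [MeasurableSpace Ω] {d : ℕ} (μ : Measure Ω) (L : ℝ)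
    (S : ℝ → Ω → Set (V d × ℝ)) (S' : Ω → Set (V d × ℝ)) : Prop :=
  (∀ᵐ ω ∂μ, ∃ f, IsGraphOver L (S' ω) f) ∧
  Tendsto (fun lam => μ {ω | ¬ ∃ f, IsGraphOver L (S lam ω) f}) atTop (𝓝 0) ∧
  TendstoInMeasure μ (fun lam ω => graphFun L (S lam ω)) atTop (fun ω => graphFun L (S' ω))

end

end GermGrain

/-! The mechanism is stabilization. The boundary of `Psi` is the graph of the infimum over germs x
of x.2 + G(x.1 - v), that of `Phi` the graph of the supremum of w.2 - G(v - w.1) over apices w of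
empty down grains. Almost surely, over the ball, each function is decided by the germs in a bounded
region, so every window containing a large enough ball yields exactly the same function.

Since `G` grows at least linearly, the germs that matter below a given height lie in a `tent`; its
intensity is finite, so almost surely they are finitely many. This settles `exists_isGraphOver_Psi`.
For `exists_isGraphOver_Phi` the empty apices must be bounded too. In the coordinates z_i = exp(h +
v_i) a down grain is a half-space cut to the positive orthant, and a germ near each axis (a `spike`
has infinite intensity) confines the relevant apices: `norm_le_of_mem_emptyApices`.

Rounding the random radii up to natural numbers gives countably many measurable events that cover
almost everything, each with a deterministic window radius. The windows eventually contain any ball,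
so on each event the finite and limiting graphs eventually coincide
(`convergesInProbabilityOver_boundaryIn`). -/

namespace GermGrain

/-! ### Growth of `G`, grains, and boundaries as graphs -/

section Geometry

variable {d : ℕ}

lemma abs_apply_le_norm (v : V d) (i : Fin d) : |(v : EuclideanSpace ℝ (Fin d)) i| ≤ ‖v‖ := by
  simpa using PiLp.norm_apply_le (v : EuclideanSpace ℝ (Fin d)) i

lemma norm_le_sum_abs (v : V d) : ‖v‖ ≤ ∑ i, |(v : EuclideanSpace ℝ (Fin d)) i| := by
  rw [Submodule.coe_norm, EuclideanSpace.norm_eq]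
  refine Real.sqrt_le_iff.2 ⟨by positivity, ?_⟩
  simp only [Real.norm_eq_abs]
  exact Finset.sum_sq_le_sq_sum_of_nonneg fun i _ => abs_nonneg _

lemma sum_apply_eq_zero (v : V d) : ∑ i, (v : EuclideanSpace ℝ (Fin d)) i = 0 := v.2

lemma exp_G (hd : 0 < d) (v : V d) :
    Real.exp (G v) = (1 / (d : ℝ)) * ∑ i, Real.exp ((v : EuclideanSpace ℝ (Fin d)) i) := by
  have : Nonempty (Fin d) := ⟨⟨0, hd⟩⟩
  have h : 0 < ∑ i, Real.exp ((v : EuclideanSpace ℝ (Fin d)) i) :=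
    Finset.sum_pos (fun i _ => Real.exp_pos _) Finset.univ_nonempty
  have : (0 : ℝ) < d := by exact_mod_cast hd
  exact Real.exp_log (by positivity)

lemma G_zero (hd : 0 < d) : G (0 : V d) = 0 := by
  have : (d : ℝ) ≠ 0 := by exact_mod_cast hd.ne'
  simp [G, this]

/-- Each coordinate changes by at most the distance, so each exponential grows by at most the factor
exp(dist u v). -/
lemma G_le_add (hd : 0 < d) (u v : V d) : G u ≤ G v + dist u v := by
  rw [← Real.exp_le_exp, Real.exp_add, exp_G hd, exp_G hd, mul_assoc, Finset.sum_mul]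
  gcongr with i
  rw [← Real.exp_add, Real.exp_le_exp, dist_eq_norm]
  have := (le_abs_self _).trans (abs_apply_le_norm (u - v) i)
  rw [Submodule.coe_sub, PiLp.sub_apply] at this
  linarith

lemma continuous_G (hd : 0 < d) : Continuous (G : V d → ℝ) :=
  (LipschitzWith.of_le_add (G_le_add hd)).continuous

lemma G_le_norm (hd : 0 < d) (v : V d) : G v ≤ ‖v‖ := by
  simpa [G_zero hd] using G_le_add hd v 0

lemma apply_sub_log_le_G (hd : 0 < d) (v : V d) (i : Fin d) :
    (v : EuclideanSpace ℝ (Fin d)) i - Real.log d ≤ G v := by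
  have hd' : (0 : ℝ) < d := by exact_mod_cast hd
  rw [← Real.exp_le_exp, Real.exp_sub, exp_G hd, Real.exp_log hd', div_eq_inv_mul, one_div]
  gcongr
  exact Finset.single_le_sum (f := fun i => Real.exp ((v : EuclideanSpace ℝ (Fin d)) i))
    (fun i _ => (Real.exp_pos _).le) (Finset.mem_univ i)

/-- The coordinates sum to zero, so the largest one, m, also controls the negative ones: all
absolute values are at most d * m. -/
lemma exists_norm_le_sq_mul_apply (hd : 0 < d) (v : V d) :
    ∃ i, ‖v‖ ≤ (d : ℝ) ^ 2 * (v : EuclideanSpace ℝ (Fin d)) i := by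
  have : Nonempty (Fin d) := ⟨⟨0, hd⟩⟩
  obtain ⟨i, hi⟩ := Finite.exists_max fun i => (v : EuclideanSpace ℝ (Fin d)) i
  set m := (v : EuclideanSpace ℝ (Fin d)) i with hm
  have hd1 : (1 : ℝ) ≤ d := by exact_mod_cast hd
  have hm0 : 0 ≤ m := by
    have h : ∑ j, (v : EuclideanSpace ℝ (Fin d)) j ≤ ∑ _j : Fin d, m :=
      Finset.sum_le_sum fun j _ => hi j
    rw [sum_apply_eq_zero] at h
    simp at h
    nlinarith
  refine ⟨i, (norm_le_sum_abs v).trans ?_⟩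
  have key : ∀ j, |(v : EuclideanSpace ℝ (Fin d)) j| ≤ d * m := by
    intro j
    refine abs_le.2 ⟨?_, (hi j).trans (by nlinarith)⟩
    have h : ∑ k, (m - (v : EuclideanSpace ℝ (Fin d)) k) = d * m := by
      rw [Finset.sum_sub_distrib, sum_apply_eq_zero]; simp
    have h2 := Finset.single_le_sum (f := fun k => m - (v : EuclideanSpace ℝ (Fin d)) k)
      (fun k _ => sub_nonneg.2 (hi k)) (Finset.mem_univ j)
    simp only [h] at h2
    linarith
  calc ∑ j, |(v : EuclideanSpace ℝ (Fin d)) j| ≤ ∑ _j : Fin d, (d * m) :=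
        Finset.sum_le_sum fun j _ => key j
    _ = (d : ℝ) ^ 2 * m := by simp; ring

lemma norm_div_sub_log_le_G (hd : 0 < d) (v : V d) : ‖v‖ / (d : ℝ) ^ 2 - Real.log d ≤ G v := by
  obtain ⟨i, hi⟩ := exists_norm_le_sq_mul_apply hd v
  have hd' : (0 : ℝ) < d := by exact_mod_cast hd
  have : ‖v‖ / (d : ℝ) ^ 2 ≤ (v : EuclideanSpace ℝ (Fin d)) i := by
    rw [div_le_iff₀ (by positivity)]; linarith
  linarith [apply_sub_log_le_G hd v i]

lemma neg_log_le_G (hd : 0 < d) (v : V d) : -Real.log d ≤ G v := by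
  have := norm_div_sub_log_le_G hd v
  have h : 0 ≤ ‖v‖ / (d : ℝ) ^ 2 := by positivity
  linarith

/-- The region below a cone; it has finite intensity. -/
def tent (d : ℕ) (c : ℝ) : Set (V d × ℝ) := {x | x.2 + ‖x.1‖ / (d : ℝ) ^ 2 ≤ c}

/-- One tent, independent of v, catches all germs whose up grain reaches down to height s somewhere
over the ball of radius r. -/
lemma mem_tent_of_add_G_le (hd : 0 < d) {x : V d × ℝ} {v : V d} {r s : ℝ} (hv : ‖v‖ ≤ r)
    (h : x.2 + G (x.1 - v) ≤ s) : x ∈ tent d (s + Real.log d + r) := by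
  have h1 := norm_div_sub_log_le_G hd (x.1 - v)
  have hd1 : (1 : ℝ) ≤ (d : ℝ) ^ 2 := one_le_pow₀ (by exact_mod_cast hd)
  have h2 : ‖x.1‖ / (d : ℝ) ^ 2 ≤ ‖x.1 - v‖ / (d : ℝ) ^ 2 + r := by
    calc ‖x.1‖ / (d : ℝ) ^ 2 ≤ (‖x.1 - v‖ + ‖v‖) / (d : ℝ) ^ 2 := by
          gcongr; simpa using norm_add_le (x.1 - v) v
      _ = ‖x.1 - v‖ / (d : ℝ) ^ 2 + ‖v‖ / (d : ℝ) ^ 2 := by ring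
      _ ≤ _ := by gcongr; exact (div_le_self (norm_nonneg _) hd1).trans hv
  simp only [tent, mem_ofPred_eq]
  linarith

lemma mem_upGrain {w : V d × ℝ} {v : V d} {h : ℝ} :
    (v, h) ∈ upGrain w ↔ w.2 + G (w.1 - v) ≤ h := by
  simp only [upGrain, upCone, image_add_left, mem_preimage, mem_ofPred_eq, Prod.fst_add,
    Prod.snd_add, Prod.fst_neg, Prod.snd_neg]
  rw [show -(-w.1 + v) = w.1 - v by abel]
  constructor <;> intro <;> linarith

lemma mem_downGrain {w : V d × ℝ} {v : V d} {h : ℝ} :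
    (v, h) ∈ downGrain w ↔ h ≤ w.2 - G (v - w.1) := by
  simp only [downGrain, downCone, image_add_left, mem_preimage, mem_ofPred_eq, Prod.fst_add,
    Prod.snd_add, Prod.fst_neg, Prod.snd_neg]
  rw [show -w.1 + v = v - w.1 by abel]
  constructor <;> intro <;> linarith

lemma mem_interior_downGrain (hd : 0 < d) {w x : V d × ℝ} :
    x ∈ interior (downGrain w) ↔ x.2 < w.2 - G (x.1 - w.1) := by
  constructor
  · intro hx
    rw [mem_interior_iff_mem_nhds] at hx
    have ht : Tendsto (fun t : ℝ => (x.1, x.2 + t)) (𝓝[>] 0) (𝓝 x) := by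
      have : ContinuousAt (fun t : ℝ => (x.1, x.2 + t)) 0 := by fun_prop
      have h2 := this.tendsto.mono_left (nhdsWithin_le_nhds (s := Ioi (0 : ℝ)))
      simpa using h2
    obtain ⟨t, ht1, ht2⟩ := ((ht.eventually hx).and self_mem_nhdsWithin).exists
    have := mem_downGrain.1 ht1
    have h0 : 0 < t := ht2
    linarith
  · intro hx
    have hG := continuous_G hd
    refine interior_maximal (s := downGrain w) (t := {y | y.2 < w.2 - G (y.1 - w.1)}) ?_ ?_ hx
    · rintro ⟨v, h⟩ hy
      exact mem_downGrain.2 (le_of_lt hy)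
    · exact isOpen_lt (by fun_prop) (by fun_prop)

/-- The apices of the down grains whose interior contains no point of `X`. -/
def emptyApices (X : Set (V d × ℝ)) : Set (V d × ℝ) :=
  {w | ∀ x ∈ X, w.2 ≤ x.2 + G (x.1 - w.1)}

lemma mem_Psi {W X : Set (V d × ℝ)} {v : V d} {h : ℝ} :
    (v, h) ∈ Psi W X ↔ (v, h) ∈ W ∧ ∃ x ∈ X, x.2 + G (x.1 - v) ≤ h := by
  simp only [Psi, mem_iUnion, mem_inter_iff, mem_upGrain]
  constructor
  · rintro ⟨x, hx, h1, h2⟩; exact ⟨h2, x, hx, h1⟩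
  · rintro ⟨h2, x, hx, h1⟩; exact ⟨x, hx, h1, h2⟩

lemma mem_Phi (hd : 0 < d) {W X : Set (V d × ℝ)} {v : V d} {h : ℝ} :
    (v, h) ∈ Phi W X ↔ (v, h) ∈ W ∧ ∃ w ∈ emptyApices X, h ≤ w.2 - G (v - w.1) := by
  have key : ∀ w : V d × ℝ, X ∩ interior (downGrain w) = ∅ ↔ w ∈ emptyApices X := by
    intro w
    simp only [eq_empty_iff_forall_notMem, mem_inter_iff, mem_interior_downGrain hd, not_and,
      emptyApices, mem_ofPred_eq, not_lt]
    refine forall₂_congr fun x _ => ?_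
    constructor <;> intro <;> linarith
  simp only [Phi, mem_iUnion, mem_inter_iff, mem_downGrain, mem_ofPred_eq, key]
  constructor
  · rintro ⟨x, hx, h1, h2⟩; exact ⟨h2, x, hx, h1⟩
  · rintro ⟨h2, x, hx, h1⟩; exact ⟨x, hx, h1, h2⟩

lemma boundaryIn_univ {E : Type*} [TopologicalSpace E] (A : Set E) :
    boundaryIn univ A = frontier A := by
  have h : frontier (Subtype.val ⁻¹' A : Set (univ : Set E)) = Subtype.val ⁻¹' frontier A :=
    ((Homeomorph.Set.univ E).preimage_frontier A).symm
  rw [boundaryIn, h]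
  simp

/-- `Phi` fills the region below its graph; passing to the complement lets the epigraph criterion
apply. -/
lemma boundaryIn_compl {E : Type*} [TopologicalSpace E] (W A : Set E) :
    boundaryIn W Aᶜ = boundaryIn W A := by
  rw [boundaryIn, preimage_compl, frontier_compl, boundaryIn]

/-- The restriction to `B(0, L)` of a function that is continuous on `B(0, L')`. -/
def restrictClosedBall {f : V d → ℝ} {L L' : ℝ} (hL : L ≤ L')
    (hf : ContinuousOn f (Metric.closedBall 0 L')) : C(Metric.closedBall (0 : V d) L, ℝ) :=
  ⟨fun v => f v, (hf.mono (Metric.closedBall_subset_closedBall hL)).comp_continuous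
    continuous_subtype_val fun v => v.2⟩

/-- In a window containing a neighbourhood of the graph of `f`, the boundary of a set lying between
the strict and the weak epigraph of `f` is the graph of `f`. -/
lemma isGraphOver_boundaryIn {W A : Set (V d × ℝ)} {f : V d → ℝ} {L L' : ℝ} (hL : L < L')
    (hf : ContinuousOn f (Metric.closedBall 0 L'))
    (hW : ∀ v ∈ Metric.closedBall (0 : V d) L', ∀ h, |h - f v| ≤ 1 → (v, h) ∈ W)
    (hup : ∀ v ∈ Metric.closedBall (0 : V d) L', ∀ h, (v, h) ∈ W → f v < h → (v, h) ∈ A)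
    (hdown : ∀ v ∈ Metric.closedBall (0 : V d) L', ∀ h, (v, h) ∈ W → h < f v → (v, h) ∉ A) :
    IsGraphOver L (boundaryIn W A) (restrictClosedBall hL.le hf) := by
  -- The slack L < L' gives points over the closed ball of radius L a full neighbourhood where the
  -- hypotheses hold.
  have hcont : ∀ x : W, x.1.1 ∈ Metric.closedBall (0 : V d) L →
      ContinuousAt (fun y : W => f y.1.1) x ∧
        ∀ᶠ y : W in 𝓝 x, y.1.1 ∈ Metric.closedBall (0 : V d) L' := by
    intro x hx
    have hx' : Metric.closedBall (0 : V d) L' ∈ 𝓝 x.1.1 :=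
      mem_of_superset (Metric.isOpen_ball.mem_nhds (x := x.1.1)
        (Metric.closedBall_subset_ball hL hx)) Metric.ball_subset_closedBall
    have hc : ContinuousAt (fun y : W => y.1.1) x := by fun_prop
    exact ⟨ContinuousAt.comp (f := fun y : W => y.1.1) (hf.continuousAt hx') hc,
      hc.eventually hx'⟩
  have hsnd : ∀ x : W, ContinuousAt (fun y : W => y.1.2) x := fun x => by fun_prop
  ext x
  simp only [mem_inter_iff, mem_ofPred_eq, mem_range, restrictClosedBall, ContinuousMap.coe_mk]
  constructor
  · rintro ⟨⟨y, hy, rfl⟩, hx⟩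
    refine ⟨⟨y.1.1, hx⟩, ?_⟩
    obtain ⟨h1, h2⟩ := hcont y hx
    rcases lt_trichotomy (f y.1.1) y.1.2 with h | h | h
    · exfalso
      refine hy.2 (mem_interior_iff_mem_nhds.2 ?_)
      filter_upwards [h1.eventually_lt (hsnd y) h, h2] with z hz hz2
      exact hup z.1.1 hz2 z.1.2 z.2 hz
    · exact Prod.ext rfl h
    · exfalso
      rw [← frontier_compl] at hy
      refine hy.2 (mem_interior_iff_mem_nhds.2 ?_)
      filter_upwards [(hsnd y).eventually_lt h1 h, h2] with z hz hz2
      exact hdown z.1.1 hz2 z.1.2 z.2 hz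
  · rintro ⟨⟨v, hv⟩, rfl⟩
    refine ⟨?_, hv⟩
    have hv' := Metric.closedBall_subset_closedBall hL.le hv
    -- A vertical segment inside W approaches the graph point from above within A and from below
    -- outside A.
    have hmem : ∀ t : Icc (-1 : ℝ) 1, (v, f v + t) ∈ W := fun t =>
      hW v hv' _ (by rw [add_sub_cancel_left, abs_le]; exact t.2)
    let c : Icc (-1 : ℝ) 1 → W := fun t => ⟨(v, f v + t), hmem t⟩
    have hc : Continuous c := by
      refine Continuous.subtype_mk ?_ _
      fun_prop
    have h0 : (0 : ℝ) ∈ Icc (-1 : ℝ) 1 := by simp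
    have hc0 : (c ⟨0, h0⟩ : V d × ℝ) = (v, f v) := by simp [c]
    have htend : ∀ (a : ℝ) (ha : |a| = 1), Tendsto (fun n : ℕ => c (⟨a * (1 / ((n : ℝ) + 1)), by
        have h1 : (0 : ℝ) < 1 / ((n : ℝ) + 1) := by positivity
        have h2 : 1 / ((n : ℝ) + 1) ≤ 1 := by
          rw [div_le_one (by positivity)]; linarith [(Nat.cast_nonneg n : (0 : ℝ) ≤ n)]
        rw [mem_Icc, ← abs_le, abs_mul, abs_of_pos h1, ha, one_mul]
        exact h2⟩)) atTop (𝓝 (c ⟨0, h0⟩)) := by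
      intro a ha
      refine (hc.tendsto _).comp ?_
      rw [tendsto_subtype_rng]
      simpa using tendsto_one_div_add_atTop_nhds_zero_nat.const_mul a
    refine ⟨c ⟨0, h0⟩, ?_, hc0⟩
    rw [frontier_eq_closure_inter_closure]
    refine ⟨mem_closure_of_tendsto (htend 1 (by simp)) (Eventually.of_forall fun n => ?_),
      mem_closure_of_tendsto (htend (-1) (by simp)) (Eventually.of_forall fun n => ?_)⟩
    · have h1 : (0 : ℝ) < 1 / ((n : ℝ) + 1) := by positivity
      exact hup v hv' _ (hmem _) (by simp only; linarith)
    · have h1 : (0 : ℝ) < 1 / ((n : ℝ) + 1) := by positivity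
      exact hdown v hv' _ (hmem _) (by simp only; linarith)

end Geometry

/-! ### Deterministic stabilization of both boundaries -/

section Localization

variable {d : ℕ}

/-- The points close to the `i`-th coordinate axis in multiplicative coordinates. -/
def spike {d : ℕ} (i : Fin d) (n : ℕ) : Set (V d × ℝ) :=
  {x | ∀ j, j ≠ i → x.2 + (x.1 : EuclideanSpace ℝ (Fin d)) j ≤ -n}

lemma abs_snd_le_of_mem_closedBall {x : V d × ℝ} {r : ℝ} (hx : x ∈ Metric.closedBall 0 r) :
    |x.2| ≤ r := by
  rw [mem_closedBall_zero_iff, norm_prod_le_iff] at hx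
  exact hx.2

lemma norm_fst_le_of_mem_closedBall {x : V d × ℝ} {r : ℝ} (hx : x ∈ Metric.closedBall 0 r) :
    ‖x.1‖ ≤ r := by
  rw [mem_closedBall_zero_iff, norm_prod_le_iff] at hx
  exact hx.1

lemma add_G_le_of_mem_closedBall (hd : 0 < d) {x : V d × ℝ} {r s : ℝ} {v : V d}
    (hx : x ∈ Metric.closedBall 0 r) (hv : ‖v‖ ≤ s) : x.2 + G (x.1 - v) ≤ 2 * r + s := by
  have h1 := (abs_le.1 (abs_snd_le_of_mem_closedBall hx)).2
  have h2 := norm_fst_le_of_mem_closedBall hx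
  have h3 := (G_le_norm hd (x.1 - v)).trans (norm_sub_le _ _)
  linarith

/-- If the points of `X` in a large enough tent are bounded, then the germs are bounded below. -/
lemma neg_le_add_G (hd : 0 < d) {X : Set (V d × ℝ)} {s r n : ℝ} (hn : 0 ≤ n) (hs : 0 ≤ s)
    (hX : X ∩ tent d (s + Real.log d + r) ⊆ Metric.closedBall 0 n) {v : V d} (hv : ‖v‖ ≤ r)
    {x : V d × ℝ} (hx : x ∈ X) : -(n + Real.log d) ≤ x.2 + G (x.1 - v) := by
  have hlog : 0 ≤ Real.log d := Real.log_natCast_nonneg d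
  -- A violating germ has a negative value, so it lies in the tent and hence in the ball, where its
  -- height is at least -n.
  by_contra! h
  have hxt := hX ⟨hx, mem_tent_of_add_G_le hd (s := s) hv (by linarith)⟩
  have h1 := (abs_le.1 (abs_snd_le_of_mem_closedBall hxt)).1
  have h2 := neg_log_le_G hd (x.1 - v)
  linarith

/-- Over `B(0, L)` the boundary of `Psi` is the same graph for all large windows. -/
theorem exists_isGraphOver_Psi (hd : 0 < d) {L : ℝ} (hL : 0 < L) (k n : ℕ) :
    ∃ N : ℝ, ∀ X : Set (V d × ℝ), (X ∩ Metric.closedBall 0 (k : ℝ)).Nonempty →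
      X ∩ tent d (2 * k + (L + 1) + 1 + Real.log d + (L + 1)) ⊆ Metric.closedBall 0 (n : ℝ) →
      ∃ F, ∀ W : Set (V d × ℝ), Metric.closedBall 0 N ⊆ W →
        IsGraphOver L (boundaryIn W (Psi W (X ∩ W))) F := by
  have hlog : 0 ≤ Real.log d := Real.log_natCast_nonneg d
  have hk : (0 : ℝ) ≤ k := by positivity
  have hn : (0 : ℝ) ≤ n := by positivity
  refine ⟨2 * k + (L + 1) + 1 + (n + Real.log d), fun X hne hX => ?_⟩
  obtain ⟨x₀, hx₀, hx₀k⟩ := hne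
  set f : V d → ℝ := fun v => sInf ((fun x : V d × ℝ => x.2 + G (x.1 - v)) '' X) with hf
  have hlow : ∀ v : V d, ‖v‖ ≤ L + 1 → ∀ x ∈ X, -(n + Real.log d) ≤ x.2 + G (x.1 - v) :=
    fun v hv x hx => neg_le_add_G hd hn (by linarith) hX hv hx
  have hbdd : ∀ v : V d, ‖v‖ ≤ L + 1 →
      BddBelow ((fun x : V d × ℝ => x.2 + G (x.1 - v)) '' X) := by
    rintro v hv
    refine ⟨-(n + Real.log d), ?_⟩
    rintro _ ⟨x, hx, rfl⟩
    exact hlow v hv x hx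
  have hfle : ∀ v : V d, ‖v‖ ≤ L + 1 → ∀ x ∈ X, f v ≤ x.2 + G (x.1 - v) :=
    fun v hv x hx => csInf_le (hbdd v hv) ⟨x, hx, rfl⟩
  have hlef : ∀ v : V d, ∀ b, (∀ x ∈ X, b ≤ x.2 + G (x.1 - v)) → b ≤ f v := by
    intro v b hb
    refine le_csInf ⟨_, x₀, hx₀, rfl⟩ ?_
    rintro _ ⟨x, hx, rfl⟩
    exact hb x hx
  have hfM : ∀ v : V d, ‖v‖ ≤ L + 1 → f v ≤ 2 * k + (L + 1) := fun v hv =>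
    (hfle v hv x₀ hx₀).trans (add_G_le_of_mem_closedBall hd hx₀k hv)
  have hcont : ContinuousOn f (Metric.closedBall 0 (L + 1)) := by
    refine (LipschitzOnWith.of_le_add fun v hv u hu => ?_).continuousOn
    rw [mem_closedBall_zero_iff] at hv hu
    rw [← sub_le_iff_le_add]
    refine hlef u _ fun x hx => ?_
    have h1 := hfle v hv x hx
    have h2 := G_le_add hd (x.1 - v) (x.1 - u)
    rw [dist_sub_left] at h2
    linarith
  refine ⟨_, fun W hW => isGraphOver_boundaryIn (lt_add_one L) hcont ?_ ?_ ?_⟩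
  · intro v hv h hh
    rw [mem_closedBall_zero_iff] at hv
    apply hW
    rw [mem_closedBall_zero_iff, norm_prod_le_iff]
    have h1 := hfM v hv
    have h2 := hlef v _ (hlow v hv)
    rw [abs_le] at hh
    exact ⟨by simp only; linarith, abs_le.2 ⟨by simp only; linarith, by simp only; linarith⟩⟩
  · intro v hv h hmem hlt
    rw [mem_closedBall_zero_iff] at hv
    refine mem_Psi.2 ⟨hmem, ?_⟩
    -- Staying below h makes the grain of x reach the point; staying below f v + 1 puts x in a tent
    -- not depending on h, hence in W.
    obtain ⟨_, ⟨x, hx, rfl⟩, hxlt⟩ := exists_lt_of_csInf_lt (⟨_, x₀, hx₀, rfl⟩ :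
      ((fun x : V d × ℝ => x.2 + G (x.1 - v)) '' X).Nonempty)
      (lt_min hlt (lt_add_one (f v)))
    have h1 := hxlt.trans_le (min_le_left _ _)
    have h2 := hxlt.trans_le (min_le_right _ _)
    have h3 := hfM v hv
    simp only at h1 h2
    refine ⟨x, ⟨hx, hW ?_⟩, h1.le⟩
    refine Metric.closedBall_subset_closedBall (by linarith)
      (hX ⟨hx, mem_tent_of_add_G_le hd hv (by linarith)⟩)
  · intro v hv h hmem hlt hPsi
    rw [mem_closedBall_zero_iff] at hv
    obtain ⟨-, x, hx, hxh⟩ := mem_Psi.1 hPsi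
    linarith [hfle v hv x hx.1]

/-- An empty down grain that reaches a given height over a given ball has a bounded apex, as soon
as there are points in the spikes. -/
lemma norm_le_of_mem_emptyApices (hd : 0 < d) {X : Set (V d × ℝ)} {b : ℝ} {n m : ℕ}
    (hb0 : 0 ≤ b) (hb : b + 1 ≤ n)
    (hX : ∀ i, (X ∩ (spike i n ∩ Metric.closedBall 0 (m : ℝ))).Nonempty) {w : V d × ℝ}
    (hw : w ∈ emptyApices X) {v : V d} {h : ℝ} (hh : h ≤ w.2 - G (v - w.1))
    (hv : -b ≤ h - ‖v‖) : ‖w‖ ≤ 2 * d * (1 + 2 * m + b + Real.log d) := by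
  have hlog : 0 ≤ Real.log d := Real.log_natCast_nonneg d
  have hd' : (0 : ℝ) < d := by exact_mod_cast hd
  have hd1 : (1 : ℝ) ≤ d := by exact_mod_cast hd
  have hm0 : (0 : ℝ) ≤ m := by positivity
  obtain ⟨u, s⟩ := w
  -- With z_i = exp(t + y_i), the down grain is the set where the sum of exp(α i) * z_i is at most
  -- 1.
  set α : Fin d → ℝ := fun i => -(u : EuclideanSpace ℝ (Fin d)) i - s - Real.log d with hα
  have hscale : ∀ (y : V d) (t : ℝ), Real.exp (t + G (y - u) - s) =
      ∑ i, Real.exp (α i + (t + (y : EuclideanSpace ℝ (Fin d)) i)) := by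
    intro y t
    rw [Real.exp_sub, Real.exp_add, exp_G hd, Finset.mul_sum, Finset.mul_sum, Finset.sum_div]
    refine Finset.sum_congr rfl fun i _ => ?_
    have : α i + (t + (y : EuclideanSpace ℝ (Fin d)) i) =
      t + ((y : EuclideanSpace ℝ (Fin d)) i - (u : EuclideanSpace ℝ (Fin d)) i) - s
        - Real.log d := by simp only [hα]; ring
    rw [this, Real.exp_sub, Real.exp_sub, Real.exp_add, Real.exp_log hd', Submodule.coe_sub,
      PiLp.sub_apply]
    field_simp
  have hle : ∑ i, Real.exp (α i - b) ≤ 1 := by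
    calc ∑ i, Real.exp (α i - b)
        ≤ ∑ i, Real.exp (α i + (h + (v : EuclideanSpace ℝ (Fin d)) i)) := by
          gcongr with i
          have := (abs_le.1 (abs_apply_le_norm v i)).1
          linarith
      _ = Real.exp (h + G (v - u) - s) := (hscale v h).symm
      _ ≤ 1 := by
          rw [Real.exp_le_one_iff]
          simp only at hh
          linarith
  have hαb : ∀ i, α i ≤ b := by
    intro i
    have := (Finset.single_le_sum (f := fun i => Real.exp (α i - b))
      (fun i _ => (Real.exp_pos _).le) (Finset.mem_univ i)).trans hle
    rw [Real.exp_le_one_iff] at this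
    linarith
  have hhalf : Real.exp (-1) ≤ 1 / 2 := by
    rw [Real.exp_neg, one_div]
    refine inv_anti₀ (by norm_num) ?_
    linarith [Real.add_one_le_exp (1 : ℝ)]
  -- The germ in the i-th spike is outside the open half-space, yet its other coordinates contribute
  -- at most 1/2, so the i-th term must supply the rest.
  have hαm : ∀ i, -1 - 2 * m ≤ α i := by
    intro i
    obtain ⟨y, hyX, hys, hym⟩ := hX i
    have h1 : 1 ≤ ∑ j, Real.exp (α j + (y.2 + (y.1 : EuclideanSpace ℝ (Fin d)) j)) := by
      rw [← hscale, Real.one_le_exp_iff]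
      have := hw y hyX
      simp only at this
      linarith
    have h2 : ∑ j ∈ Finset.univ.erase i,
        Real.exp (α j + (y.2 + (y.1 : EuclideanSpace ℝ (Fin d)) j)) ≤ 1 / 2 := by
      calc _ ≤ ∑ j ∈ Finset.univ.erase i, Real.exp (α j - b) * Real.exp (-1) := by
            refine Finset.sum_le_sum fun j hj => ?_
            rw [← Real.exp_add, Real.exp_le_exp]
            have := hys j (Finset.ne_of_mem_erase hj)
            linarith
        _ ≤ ∑ j, Real.exp (α j - b) * Real.exp (-1) :=
            Finset.sum_le_sum_of_subset_of_nonneg (Finset.erase_subset _ _)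
              fun _ _ _ => by positivity
        _ ≤ 1 * Real.exp (-1) := by
            rw [← Finset.sum_mul]
            gcongr
        _ ≤ 1 / 2 := by linarith
    rw [← Finset.add_sum_erase _ _ (Finset.mem_univ i)] at h1
    have h3 : Real.exp (-1) ≤
        Real.exp (α i + (y.2 + (y.1 : EuclideanSpace ℝ (Fin d)) i)) := by linarith
    rw [Real.exp_le_exp] at h3
    have h4 := (abs_le.1 (abs_snd_le_of_mem_closedBall hym)).2
    have h5 := (abs_le.1 ((abs_apply_le_norm y.1 i).trans
      (norm_fst_le_of_mem_closedBall hym))).2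
    linarith
  set q : ℝ := 1 + 2 * m + b + Real.log d with hq
  have hq0 : 0 ≤ q := by positivity
  have hus : ∀ i, |(u : EuclideanSpace ℝ (Fin d)) i + s| ≤ q := by
    intro i
    have h1 := hαb i
    have h2 := hαm i
    simp only [hα] at h1 h2
    rw [abs_le]
    constructor <;> linarith
  -- Averaging over i eliminates u, whose coordinates sum to zero.
  have hs : |s| ≤ q := by
    have h1 : ∑ i, ((u : EuclideanSpace ℝ (Fin d)) i + s) = d * s := by
      rw [Finset.sum_add_distrib, sum_apply_eq_zero]; simp
    have h2 : |(d : ℝ) * s| ≤ d * q := by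
      rw [← h1]
      refine (Finset.abs_sum_le_sum_abs _ _).trans ((Finset.sum_le_sum fun i _ => hus i).trans ?_)
      simp
    rw [abs_mul, abs_of_pos hd'] at h2
    exact le_of_mul_le_mul_left h2 hd'
  rw [norm_prod_le_iff]
  refine ⟨(norm_le_sum_abs u).trans ?_, ?_⟩
  · calc ∑ i, |(u : EuclideanSpace ℝ (Fin d)) i| ≤ ∑ _i : Fin d, 2 * q := by
          refine Finset.sum_le_sum fun i _ => ?_
          have := abs_sub ((u : EuclideanSpace ℝ (Fin d)) i + s) s
          rw [add_sub_cancel_right] at this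
          linarith [hus i]
      _ = 2 * d * q := by simp; ring
  · rw [Real.norm_eq_abs]
    refine hs.trans ?_
    nlinarith

/-- Over `B(0, L)` the boundary of `Phi` is the same graph for all large windows. -/
theorem exists_isGraphOver_Phi (hd : 0 < d) {L : ℝ} (hL : 0 < L) (n : ℕ) :
    ∃ n' : ℕ, ∀ m : ℕ, ∃ R : ℝ, ∀ p : ℕ, ∃ N : ℝ, ∀ X : Set (V d × ℝ),
      X ∩ tent d (0 + Real.log d + (L + 1)) ⊆ Metric.closedBall 0 (n : ℝ) →
      (∀ i, (X ∩ (spike i n' ∩ Metric.closedBall 0 (m : ℝ))).Nonempty) →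
      X ∩ tent d (R + Real.log d + R) ⊆ Metric.closedBall 0 (p : ℝ) →
      ∃ F, ∀ W : Set (V d × ℝ), Metric.closedBall 0 N ⊆ W →
        IsGraphOver L (boundaryIn W (Phi W (X ∩ W))) F := by
  have hlog : 0 ≤ Real.log d := Real.log_natCast_nonneg d
  have hn : (0 : ℝ) ≤ n := by positivity
  set a : ℝ := n + Real.log d with ha
  have ha0 : 0 ≤ a := by positivity
  obtain ⟨n', hn'⟩ := exists_nat_ge (a + 1 + (L + 1) + 1)
  -- The apex bound is fixed before p, so p may bound the germs in a tent defined by it.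
  refine ⟨n', fun m => ⟨2 * d * (1 + 2 * m + (a + 1 + (L + 1)) + Real.log d), fun p => ?_⟩⟩
  have hm0 : (0 : ℝ) ≤ m := by positivity
  have hp0 : (0 : ℝ) ≤ p := by positivity
  set R : ℝ := 2 * d * (1 + 2 * m + (a + 1 + (L + 1)) + Real.log d) with hR
  have hR0 : 0 ≤ R := by positivity
  refine ⟨m + p + L + 1 + a + 1 + R + Real.log d, fun X hX hspike hXp => ?_⟩
  have hbound : ∀ W : Set (V d × ℝ), Metric.closedBall 0 (m : ℝ) ⊆ W →
      ∀ w ∈ emptyApices (X ∩ W), ∀ v : V d, ‖v‖ ≤ L + 1 → ∀ h, h ≤ w.2 - G (v - w.1) →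
        -(a + 1) ≤ h → ‖w‖ ≤ R := by
    intro W hW w hw v hv h hh hah
    refine norm_le_of_mem_emptyApices hd (by positivity) hn' (fun i => ?_) hw hh (by linarith)
    obtain ⟨y, hy1, hy2, hy3⟩ := hspike i
    exact ⟨y, ⟨hy1, hW hy3⟩, hy2, hy3⟩
  set S : V d → Set ℝ := fun v => (fun w : V d × ℝ => w.2 - G (v - w.1)) '' emptyApices X with hS
  set g : V d → ℝ := fun v => sSup (S v) with hg
  have hlow : ∀ v : V d, ‖v‖ ≤ L + 1 → (v, -a) ∈ emptyApices X := fun v hv x hx =>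
    neg_le_add_G hd hn le_rfl hX hv hx
  have hmemS : ∀ v : V d, ‖v‖ ≤ L + 1 → -a ∈ S v := fun v hv =>
    ⟨(v, -a), hlow v hv, by simp [G_zero hd]⟩
  have hupS : ∀ v : V d, ‖v‖ ≤ L + 1 → ∀ t ∈ S v, t ≤ R + Real.log d := by
    rintro v hv _ ⟨w, hw, rfl⟩
    by_cases h : -(a + 1) ≤ w.2 - G (v - w.1)
    · have h1 := hbound univ (subset_univ _) w (by simpa using hw) v hv _ le_rfl h
      have h2 := (le_abs_self w.2).trans ((norm_snd_le w).trans h1)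
      have h3 := neg_log_le_G hd (v - w.1)
      simp only
      linarith
    · simp only at h ⊢
      linarith
  have hbdd : ∀ v : V d, ‖v‖ ≤ L + 1 → BddAbove (S v) := fun v hv =>
    ⟨R + Real.log d, fun t ht => hupS v hv t ht⟩
  have hcont : ContinuousOn g (Metric.closedBall 0 (L + 1)) := by
    refine (LipschitzOnWith.of_le_add fun v hv u hu => ?_).continuousOn
    rw [mem_closedBall_zero_iff] at hv hu
    refine csSup_le ⟨_, hmemS v hv⟩ ?_
    rintro _ ⟨w, hw, rfl⟩
    have h1 : w.2 - G (u - w.1) ≤ g u := le_csSup (hbdd u hu) ⟨w, hw, rfl⟩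
    have h2 := G_le_add hd (u - w.1) (v - w.1)
    rw [dist_sub_right, dist_comm] at h2
    simp only
    linarith
  refine ⟨restrictClosedBall (lt_add_one L).le hcont, fun W hW => ?_⟩
  rw [← boundaryIn_compl]
  refine isGraphOver_boundaryIn (lt_add_one L) hcont ?_ ?_ ?_
  · intro v hv h hh
    rw [mem_closedBall_zero_iff] at hv
    apply hW
    rw [mem_closedBall_zero_iff, norm_prod_le_iff]
    have h1 : g v ≤ R + Real.log d := csSup_le ⟨_, hmemS v hv⟩ (hupS v hv)
    have h2 : -a ≤ g v := le_csSup (hbdd v hv) (hmemS v hv)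
    rw [abs_le] at hh
    exact ⟨by simp only; linarith, abs_le.2 ⟨by simp only; linarith, by simp only; linarith⟩⟩
  · intro v hv h hmem hlt hPhi
    rw [mem_closedBall_zero_iff] at hv
    obtain ⟨-, w, hw, hwh⟩ := (mem_Phi hd).1 hPhi
    have h2 : -a ≤ g v := le_csSup (hbdd v hv) (hmemS v hv)
    have hmW : Metric.closedBall 0 (m : ℝ) ⊆ W :=
      (Metric.closedBall_subset_closedBall (by linarith)).trans hW
    have hpW : Metric.closedBall 0 (p : ℝ) ⊆ W :=
      (Metric.closedBall_subset_closedBall (by linarith)).trans hW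
    have hwR := hbound W hmW w hw v hv h hwh (by linarith)
    -- Emptiness in the window implies emptiness for all of X: a germ inside this grain would lie in
    -- the tent given by R, hence in the ball of radius p and in W.
    have hw' : w ∈ emptyApices X := by
      intro x hx
      by_cases hxW : x ∈ W
      · exact hw x ⟨hx, hxW⟩
      · by_contra! hlt'
        have h3 := (le_abs_self w.2).trans ((norm_snd_le w).trans hwR)
        exact hxW (hpW (hXp ⟨hx, mem_tent_of_add_G_le hd ((norm_fst_le w).trans hwR)
          (by linarith)⟩))
    have h3 : w.2 - G (v - w.1) ≤ g v := le_csSup (hbdd v hv) ⟨w, hw', rfl⟩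
    linarith
  · intro v hv h hmem hlt
    rw [mem_closedBall_zero_iff] at hv
    rw [notMem_compl_iff]
    obtain ⟨_, ⟨w, hw, rfl⟩, hwlt⟩ := exists_lt_of_lt_csSup ⟨_, hmemS v hv⟩ hlt
    -- Removing germs keeps an empty grain empty.
    exact (mem_Phi hd).2 ⟨hmem, w, fun x hx => hw x hx.1, le_of_lt hwlt⟩

end Localization

/-! ### Void probabilities and almost sure finiteness -/

section Poisson

variable {Ω E : Type*} [MeasurableSpace Ω] [TopologicalSpace E] [MeasurableSpace E]
  {μ : Measure Ω} {Λ : Measure E} {P : Ω → Set E}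

lemma IsPoissonProcess.measurableSet_inter_nonempty (hP : IsPoissonProcess μ Λ P) {B : Set E}
    (hB : MeasurableSet B) : MeasurableSet {ω | (P ω ∩ B).Nonempty} := by
  have h : {ω | (P ω ∩ B).Nonempty} = (fun ω => (P ω ∩ B).encard) ⁻¹' {0}ᶜ := by
    ext ω
    simp [nonempty_iff_ne_empty]
  rw [h]
  exact hP.measurable_count B hB (measurableSet_singleton 0).compl

lemma IsPoissonProcess.measurableSet_inter_subset (hP : IsPoissonProcess μ Λ P) {B C : Set E}
    (hB : MeasurableSet B) (hC : MeasurableSet C) : MeasurableSet {ω | P ω ∩ B ⊆ C} := by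
  have h : {ω | P ω ∩ B ⊆ C} = {ω | (P ω ∩ (B \ C)).Nonempty}ᶜ := by
    ext ω
    rw [mem_compl_iff, mem_ofPred_eq, mem_ofPred_eq, not_nonempty_iff_eq_empty, ← inter_sdiff_assoc,
      sdiff_eq_empty]
  rw [h]
  exact (hP.measurableSet_inter_nonempty (hB.diff hC)).compl

lemma IsPoissonProcess.measure_inter_eq_empty (hP : IsPoissonProcess μ Λ P) {B : Set E}
    (hB : MeasurableSet B) (hΛ : Λ B ≠ ⊤) :
    μ {ω | P ω ∩ B = ∅} = ENNReal.ofReal (Real.exp (-(Λ B).toReal)) := by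
  have h1 := congrArg (fun ν => ν {(0 : ℕ∞)}) (hP.law_count B hB hΛ)
  rw [Measure.map_apply (hP.measurable_count B hB) (measurableSet_singleton _),
    Measure.map_apply (by fun_prop) (measurableSet_singleton _)] at h1
  have h2 : (fun n : ℕ => (n : ℕ∞)) ⁻¹' {0} = {0} := by ext n; simp
  have h3 : (fun ω => (P ω ∩ B).encard) ⁻¹' {0} = {ω | P ω ∩ B = ∅} := by ext ω; simp
  rw [h2, h3, poissonMeasure_singleton] at h1
  rw [h1]
  simp [ENNReal.coe_toNNReal_eq_toReal]

lemma IsPoissonProcess.ae_finite (hP : IsPoissonProcess μ Λ P) {B : Set E}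
    (hB : MeasurableSet B) (hΛ : Λ B ≠ ⊤) : ∀ᵐ ω ∂μ, (P ω ∩ B).Finite := by
  have h1 := congrArg (fun ν => ν {(⊤ : ℕ∞)}) (hP.law_count B hB hΛ)
  rw [Measure.map_apply (hP.measurable_count B hB) (measurableSet_singleton _),
    Measure.map_apply (by fun_prop) (measurableSet_singleton _)] at h1
  have h2 : (fun n : ℕ => (n : ℕ∞)) ⁻¹' {⊤} = ∅ := by ext n; simp
  rw [h2, measure_empty] at h1
  refine measure_mono_null (fun ω hω => ?_) h1
  simpa using hω

/-- The void probabilities exp(-Λ(Q t)) tend to zero. Testing on subsets of finite measure allows B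
to have infinite measure. -/
lemma IsPoissonProcess.ae_inter_nonempty (hP : IsPoissonProcess μ Λ P) {B : Set E} {Q : ℕ → Set E}
    (hQ : ∀ t, MeasurableSet (Q t)) (hQB : ∀ t, Q t ⊆ B) (hΛ : ∀ t, Λ (Q t) ≠ ⊤)
    (hlim : Tendsto (fun t => (Λ (Q t)).toReal) atTop atTop) :
    ∀ᵐ ω ∂μ, (P ω ∩ B).Nonempty := by
  have h1 : ∀ t, μ {ω | ¬ (P ω ∩ B).Nonempty} ≤
      ENNReal.ofReal (Real.exp (-(Λ (Q t)).toReal)) := by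
    intro t
    rw [← hP.measure_inter_eq_empty (hQ t) (hΛ t)]
    refine measure_mono fun ω hω => ?_
    have h2 : P ω ∩ B = ∅ := not_nonempty_iff_eq_empty.1 hω
    exact subset_eq_empty (inter_subset_inter_right _ (hQB t)) h2
  have h2 : Tendsto (fun t => ENNReal.ofReal (Real.exp (-(Λ (Q t)).toReal))) atTop (𝓝 0) := by
    rw [← ENNReal.ofReal_zero]
    exact ENNReal.tendsto_ofReal
      (Real.tendsto_exp_atBot.comp (tendsto_neg_atTop_atBot.comp hlim))
  exact le_antisymm (ge_of_tendsto' h2 h1) zero_le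

end Poisson

/-! ### Tents have finite intensity, spikes infinite -/

section Intensity

variable {d : ℕ}

/-- Comparison with (1 + ‖v‖)^(-r), r one more than the dimension, through x^r / r! ≤ exp x. -/
lemma integrable_exp_neg_mul_norm {E : Type*} [NormedAddCommGroup E] [NormedSpace ℝ E]
    [FiniteDimensional ℝ E] [MeasurableSpace E] [BorelSpace E] (μ : Measure E)
    [μ.IsAddHaarMeasure] {b : ℝ} (hb : 0 < b) : Integrable (fun v => Real.exp (-b * ‖v‖)) μ := by
  set r : ℕ := Module.finrank ℝ E + 1 with hr
  have h1 : Integrable (fun v : E => (1 + ‖v‖) ^ (-(r : ℝ))) μ :=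
    integrable_one_add_norm (by rw [hr]; push_cast; linarith)
  refine (h1.const_mul (Real.exp b * r.factorial / b ^ r)).mono'
    (by fun_prop) (Eventually.of_forall fun v => ?_)
  rw [Real.norm_eq_abs, abs_of_pos (Real.exp_pos _)]
  have hv : 0 < 1 + ‖v‖ := by positivity
  have h2 := Real.pow_div_factorial_le_exp (b * (1 + ‖v‖)) (by positivity) r
  rw [Real.rpow_neg hv.le, Real.rpow_natCast, ← div_eq_mul_inv, div_div,
    le_div_iff₀ (by positivity)]
  rw [div_le_iff₀ (by positivity)] at h2
  calc Real.exp (-b * ‖v‖) * (b ^ r * (1 + ‖v‖) ^ r)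
      = Real.exp (-b * ‖v‖) * (b * (1 + ‖v‖)) ^ r := by rw [mul_pow]
    _ ≤ Real.exp (-b * ‖v‖) * (Real.exp (b * (1 + ‖v‖)) * r.factorial) := by gcongr
    _ = Real.exp b * r.factorial := by
      rw [← mul_assoc, ← Real.exp_add]
      congr 2
      ring

lemma measurableSet_tent (c : ℝ) : MeasurableSet (tent d c) := by
  refine (isClosed_le (f := fun x : V d × ℝ => x.2 + ‖x.1‖ / (d : ℝ) ^ 2) (g := fun _ => c)
    ?_ ?_).measurableSet <;> fun_prop

/-- The exponent d * h is split in half: one half is integrable over h ≤ c, the other is turned by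
the tent inequality into exponential decay in ‖v‖. -/
lemma intensity_tent_ne_top (hd : 0 < d) (c : ℝ) : intensity d (tent d c) ≠ ⊤ := by
  have hd' : (0 : ℝ) < d := by exact_mod_cast hd
  have h1 : Integrable (fun v : V d => Real.exp (-(1 / (2 * d)) * ‖v‖)) volume :=
    integrable_exp_neg_mul_norm _ (by positivity)
  have h2 : Integrable ((Iic c).indicator fun h : ℝ => Real.exp (d / 2 * h)) volume :=
    (integrableOn_exp_mul_Iic (by positivity) c).integrable_indicator measurableSet_Iic
  have h3 := (h1.mul_prod h2).const_mul (Real.sqrt d * Real.exp (d * c / 2))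
  rw [intensity, withDensity_apply _ (measurableSet_tent c)]
  refine ne_top_of_le_ne_top h3.lintegral_lt_top.ne ?_
  rw [← lintegral_indicator (measurableSet_tent c)]
  refine lintegral_mono fun x => ?_
  by_cases hx : x ∈ tent d c
  · rw [indicator_of_mem hx]
    refine ENNReal.ofReal_le_ofReal ?_
    have hx' : x.2 + ‖x.1‖ / (d : ℝ) ^ 2 ≤ c := hx
    have hxc : x.2 ∈ Iic c := by
      have : 0 ≤ ‖x.1‖ / (d : ℝ) ^ 2 := by positivity
      rw [mem_Iic]; linarith
    rw [indicator_of_mem hxc, mul_assoc, ← Real.exp_add, ← Real.exp_add]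
    gcongr
    have h4 : ‖x.1‖ / (d : ℝ) ^ 2 * (d / 2) = 1 / (2 * d) * ‖x.1‖ := by field_simp
    nlinarith [mul_le_mul_of_nonneg_right hx' (by positivity : (0 : ℝ) ≤ d / 2)]
  · rw [indicator_of_notMem hx]
    exact zero_le

lemma measurableSet_spike (i : Fin d) (n : ℕ) : MeasurableSet (spike i n) := by
  have h : spike i n = ⋂ j, ⋂ (_ : j ≠ i),
      {x : V d × ℝ | x.2 + (x.1 : EuclideanSpace ℝ (Fin d)) j ≤ -n} := by
    ext x; simp [spike]
  rw [h]
  refine MeasurableSet.iInter fun j => MeasurableSet.iInter fun _ =>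
    (isClosed_le ?_ ?_).measurableSet <;> fun_prop

/-- The direction in `V` of the `i`-th coordinate axis. -/
def axis (i : Fin d) : V d :=
  ⟨WithLp.toLp 2 fun j => if j = i then (d : ℝ) - 1 else -1, by
    have h : ∀ j : Fin d, (if j = i then (d : ℝ) - 1 else -1) = (if j = i then (d : ℝ) else 0) - 1 :=
      fun j => by split_ifs <;> ring
    show ∑ j, (if j = i then (d : ℝ) - 1 else -1) = 0
    simp [h]⟩

lemma axis_apply_of_ne {i j : Fin d} (h : j ≠ i) : (axis i : EuclideanSpace ℝ (Fin d)) j = -1 := by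
  simp [axis, h]

/-- Boxes of large intensity in the spikes. -/
def spikeBox (i : Fin d) (n t : ℕ) : Set (V d × ℝ) :=
  Metric.closedBall ((t : ℝ) • axis i) 1 ×ˢ Icc ((t : ℝ) - n - 2) ((t : ℝ) - n - 1)

lemma spikeBox_subset_spike (i : Fin d) (n t : ℕ) : spikeBox i n t ⊆ spike i n := by
  rintro ⟨v, h⟩ ⟨hv, hh⟩ j hj
  rw [mem_closedBall_iff_norm] at hv
  have h1 := (abs_le.1 ((abs_apply_le_norm (v - (t : ℝ) • axis i) j).trans hv)).2
  rw [Submodule.coe_sub, Submodule.coe_smul, PiLp.sub_apply, PiLp.smul_apply,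
    axis_apply_of_ne hj, smul_eq_mul] at h1
  have h2 : h ≤ (t : ℝ) - n - 1 := hh.2
  simp only
  linarith

lemma isCompact_spikeBox (i : Fin d) (n t : ℕ) : IsCompact (spikeBox i n t) :=
  (isCompact_closedBall _ _).prod isCompact_Icc

lemma intensity_ne_top_of_isCompact {K : Set (V d × ℝ)} (hK : IsCompact K) :
    intensity d K ≠ ⊤ := by
  have h : IntegrableOn (fun x : V d × ℝ => Real.sqrt d * Real.exp (d * x.2)) K volume :=
    ContinuousOn.integrableOn_compact hK (by fun_prop)
  rw [intensity, withDensity_apply _ hK.measurableSet]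
  exact h.lintegral_lt_top.ne

/-- The boxes have constant volume and rise with t, so the density on them tends to infinity; the
linear bound y ≤ exp y is enough. -/
lemma tendsto_intensity_spikeBox (hd : 0 < d) (i : Fin d) (n : ℕ) :
    Tendsto (fun t => (intensity d (spikeBox i n t)).toReal) atTop atTop := by
  have hd' : (0 : ℝ) < d := by exact_mod_cast hd
  have hd1 : (1 : ℝ) ≤ d := by exact_mod_cast hd
  set c : ℝ := (volume (Metric.closedBall (0 : V d) 1)).toReal with hc
  have hc0 : 0 < c := ENNReal.toReal_pos
    (Metric.measure_closedBall_pos _ _ one_pos).ne' measure_closedBall_lt_top.ne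
  have hvol : ∀ t, volume (spikeBox i n t) = ENNReal.ofReal c := by
    intro t
    rw [spikeBox, Measure.volume_eq_prod, Measure.prod_prod, Measure.addHaar_closedBall_center,
      Real.volume_Icc, hc, ENNReal.ofReal_toReal measure_closedBall_lt_top.ne]
    norm_num
  have hle : ∀ t : ℕ, Real.sqrt d * (d * ((t : ℝ) - n - 2)) * c ≤
      (intensity d (spikeBox i n t)).toReal := by
    intro t
    refine (ENNReal.ofReal_le_iff_le_toReal
      (intensity_ne_top_of_isCompact (isCompact_spikeBox i n t))).1 ?_
    rw [ENNReal.ofReal_mul' hc0.le, ← hvol t, intensity,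
      withDensity_apply _ (isCompact_spikeBox i n t).measurableSet, ← setLIntegral_const]
    refine setLIntegral_mono' (isCompact_spikeBox i n t).measurableSet fun x hx => ?_
    refine ENNReal.ofReal_le_ofReal ?_
    gcongr
    refine le_trans ?_ ((lt_add_one _).le.trans (Real.add_one_le_exp _))
    gcongr
    exact hx.2.1
  refine tendsto_atTop_mono hle (Tendsto.atTop_mul_const hc0 ?_)
  refine Tendsto.const_mul_atTop (Real.sqrt_pos.2 hd') (Tendsto.const_mul_atTop hd' ?_)
  simp only [sub_eq_add_neg]
  exact tendsto_atTop_add_const_right _ _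
    (tendsto_atTop_add_const_right _ _ tendsto_natCast_atTop_atTop)

lemma IsPoissonProcess.ae_inter_spike_nonempty {Ω : Type*} [MeasurableSpace Ω] {μ : Measure Ω}
    {P : Ω → Set (V d × ℝ)} (hP : IsPoissonProcess μ (intensity d) P) (i : Fin d) (n : ℕ) :
    ∀ᵐ ω ∂μ, (P ω ∩ spike i n).Nonempty :=
  hP.ae_inter_nonempty (fun t => (isCompact_spikeBox i n t).measurableSet)
    (spikeBox_subset_spike i n) (fun t => intensity_ne_top_of_isCompact (isCompact_spikeBox i n t))
    (tendsto_intensity_spikeBox i.pos i n)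

end Intensity

/-! ### The windows exhaust the space -/

section Window

/-- With y = log λ this is y / d - y^(1/d), and the linear term wins because 1/d < 1. -/
lemma tendsto_log_mul_delta0 {d : ℕ} (hd : 2 ≤ d) :
    Tendsto (fun lam : ℝ => Real.log (lam ^ (1 / (d : ℝ)) * delta0 d lam)) atTop atTop := by
  have hd' : (2 : ℝ) ≤ d := by exact_mod_cast hd
  have hlt : 1 / (d : ℝ) < 1 := by rw [div_lt_one (by linarith)]; linarith
  have h1 : Tendsto (fun y : ℝ => y * (1 / (d : ℝ) - y ^ (-(1 - 1 / (d : ℝ))))) atTop atTop := by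
    refine Tendsto.atTop_mul_pos (C := 1 / (d : ℝ)) (by positivity) tendsto_id ?_
    simpa using (tendsto_rpow_neg_atTop (sub_pos.2 hlt)).const_sub (1 / (d : ℝ))
  refine (h1.comp Real.tendsto_log_atTop).congr' ?_
  filter_upwards [eventually_gt_atTop 1] with lam hlam
  have h0 : 0 < lam := one_pos.trans hlam
  have hlog : 0 < Real.log lam := Real.log_pos hlam
  rw [delta0, Real.log_mul (Real.rpow_pos_of_pos h0 _).ne' (Real.exp_pos _).ne', Real.log_rpow h0,
    Real.log_exp, Function.comp_apply, mul_sub]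
  have h2 : Real.log lam * Real.log lam ^ (-(1 - 1 / (d : ℝ))) = Real.log lam ^ (1 / (d : ℝ)) := by
    nth_rewrite 1 [← Real.rpow_one (Real.log lam)]
    rw [← Real.rpow_add hlog]
    congr 1
    ring
  rw [h2]
  ring

lemma eventually_closedBall_subset_window {d : ℕ} (hd : 2 ≤ d) (N : ℝ) :
    ∀ᶠ lam in atTop, Metric.closedBall (0 : V d × ℝ) N ⊆ window d lam := by
  filter_upwards [(tendsto_log_mul_delta0 hd).eventually_ge_atTop (2 * N)] with lam hlam x hx i
  have h1 := (abs_le.1 (abs_snd_le_of_mem_closedBall hx)).2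
  have h2 := (abs_le.1 ((abs_apply_le_norm x.1 i).trans (norm_fst_le_of_mem_closedBall hx))).2
  linarith

end Window

/-! ### From eventual coincidence to convergence in probability -/

section Convergence

variable {Ω : Type*} [MeasurableSpace Ω] {μ : Measure Ω} [IsProbabilityMeasure μ]

/-- If, on each of countably many events that cover almost everything, the bad event eventually
does not occur, then its probability tends to zero. -/
lemma tendsto_measure_zero_of_cover {ι κ : Type*} [Countable ι] {l : Filter κ} {A : ι → Set Ω}
    (hA : ∀ i, MeasurableSet (A i)) (hcover : ∀ᵐ ω ∂μ, ∃ i, ω ∈ A i) {bad : κ → Set Ω}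
    (hbad : ∀ i, ∀ᶠ a in l, Disjoint (A i) (bad a)) :
    Tendsto (fun a => μ (bad a)) l (𝓝 0) := by
  have hne : Nonempty ι := by
    obtain ⟨ω, i, -⟩ := hcover.exists
    exact ⟨i⟩
  obtain ⟨e, he⟩ := exists_surjective_nat ι
  -- Finitely many of the events already miss only a set of small measure, and finitely many
  -- eventual statements hold together.
  have h1 := tendsto_measure_iInter_le (μ := μ) (f := fun n : ℕ => (A (e n))ᶜ)
    (fun n => (hA _).compl.nullMeasurableSet) ⟨0, measure_ne_top _ _⟩
  have h2 : μ (⋂ n : ℕ, (A (e n))ᶜ) = 0 := by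
    refine measure_mono_null (fun ω hω => ?_) hcover
    rintro ⟨i, hi⟩
    obtain ⟨n, rfl⟩ := he i
    exact mem_iInter.1 hω n hi
  rw [h2] at h1
  rw [ENNReal.tendsto_nhds_zero]
  intro ε hε
  obtain ⟨n, hn⟩ := ((ENNReal.tendsto_nhds_zero.1 h1) ε hε).exists
  have h3 : ∀ᶠ a in l, ∀ j ∈ Iic n, Disjoint (A (e j)) (bad a) :=
    (eventually_all_finite (finite_Iic n)).2 fun j _ => hbad (e j)
  filter_upwards [h3] with a ha
  refine (measure_mono fun ω hω => ?_).trans hn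
  exact mem_iInter₂.2 fun j hj hωj => disjoint_left.1 (ha j hj) hωj hω

/-- A graph determines its function, so the choice in `graphFun` is harmless. -/
lemma graphFun_eq {d : ℕ} {L : ℝ} {S : Set (V d × ℝ)} {F : C(Metric.closedBall (0 : V d) L, ℝ)}
    (h : IsGraphOver L S F) : graphFun L S = F := by
  have hex : ∃ f, IsGraphOver L S f := ⟨F, h⟩
  rw [graphFun, dif_pos hex]
  have h1 : IsGraphOver L S hex.choose := hex.choose_spec
  ext v
  have h2 : ((v : V d), F v) ∈ range fun v : Metric.closedBall (0 : V d) L =>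
      ((v : V d), hex.choose v) := by
    rw [← h1, h]
    exact ⟨v, rfl⟩
  obtain ⟨u, hu⟩ := h2
  rw [Prod.ext_iff] at hu
  obtain rfl := Subtype.ext hu.1
  exact hu.2

lemma convergesInProbabilityOver_of_cover {d : ℕ} {L : ℝ} {S : ℝ → Ω → Set (V d × ℝ)}
    {S' : Ω → Set (V d × ℝ)} {ι : Type*} [Countable ι] {A : ι → Set Ω}
    (hA : ∀ i, MeasurableSet (A i)) (hcover : ∀ᵐ ω ∂μ, ∃ i, ω ∈ A i)
    (hS : ∀ i, ∀ᶠ lam in atTop, ∀ ω ∈ A i,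
      ∃ F, IsGraphOver L (S lam ω) F ∧ IsGraphOver L (S' ω) F) :
    ConvergesInProbabilityOver μ L S S' := by
  refine ⟨?_, tendsto_measure_zero_of_cover hA hcover fun i => ?_, fun ε hε =>
    tendsto_measure_zero_of_cover hA hcover fun i => ?_⟩
  · filter_upwards [hcover] with ω hω
    obtain ⟨i, hi⟩ := hω
    obtain ⟨lam, hlam⟩ := (hS i).exists
    obtain ⟨F, -, hF⟩ := hlam ω hi
    exact ⟨F, hF⟩
  · filter_upwards [hS i] with lam hlam
    refine disjoint_left.2 fun ω hω hbad => hbad ?_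
    obtain ⟨F, hF, -⟩ := hlam ω hω
    exact ⟨F, hF⟩
  · filter_upwards [hS i] with lam hlam
    refine disjoint_left.2 fun ω hω hbad => ?_
    obtain ⟨F, hF, hF'⟩ := hlam ω hω
    rw [mem_ofPred_eq, graphFun_eq hF, graphFun_eq hF', edist_self] at hbad
    exact hbad.not_gt hε

/-- Convergence in probability of the boundaries of a germ-grain model that is, on each of countably
many events covering almost everything, the same graph in all large windows. -/
lemma convergesInProbabilityOver_boundaryIn {d : ℕ} (hd : 2 ≤ d) {L : ℝ}
    {M : Set (V d × ℝ) → Set (V d × ℝ) → Set (V d × ℝ)} {P : Ω → Set (V d × ℝ)}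
    {ι : Type*} [Countable ι] {A : ι → Set Ω} (N : ι → ℝ)
    (hA : ∀ i, MeasurableSet (A i)) (hcover : ∀ᵐ ω ∂μ, ∃ i, ω ∈ A i)
    (hM : ∀ i, ∀ ω ∈ A i, ∃ F, ∀ W, Metric.closedBall 0 (N i) ⊆ W →
      IsGraphOver L (boundaryIn W (M W (P ω ∩ W))) F) :
    ConvergesInProbabilityOver μ L
      (fun lam ω => boundaryIn (window d lam) (M (window d lam) (P ω ∩ window d lam)))
      (fun ω => frontier (M univ (P ω))) := by
  refine convergesInProbabilityOver_of_cover hA hcover fun i => ?_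
  filter_upwards [eventually_closedBall_subset_window hd (N i)] with lam hlam ω hω
  obtain ⟨F, hF⟩ := hM i ω hω
  refine ⟨F, hF _ hlam, ?_⟩
  simpa only [inter_univ, boundaryIn_univ] using hF univ (subset_univ _)

end Convergence

/-! ### Countable covers by good events -/

section Events

variable {d : ℕ} {Ω : Type*} [MeasurableSpace Ω] {μ : Measure Ω} {P : Ω → Set (V d × ℝ)}

lemma exists_nat_subset_closedBall {E : Type*} [SeminormedAddCommGroup E] {s : Set E}
    (hs : s.Finite) : ∃ n : ℕ, s ⊆ Metric.closedBall 0 (n : ℝ) := by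
  obtain ⟨r, hr⟩ := hs.isBounded.subset_closedBall 0
  obtain ⟨n, hn⟩ := exists_nat_ge r
  exact ⟨n, hr.trans (Metric.closedBall_subset_closedBall hn)⟩

/-- Tents increase with c, so natural values of c suffice and a single null set serves all real c,
including values depending on ω. -/
lemma IsPoissonProcess.ae_exists_tent_subset_closedBall (hd : 0 < d)
    (hP : IsPoissonProcess μ (intensity d) P) :
    ∀ᵐ ω ∂μ, ∀ c : ℝ, ∃ n : ℕ, P ω ∩ tent d c ⊆ Metric.closedBall 0 (n : ℝ) := by
  have h : ∀ᵐ ω ∂μ, ∀ m : ℕ, (P ω ∩ tent d (m : ℝ)).Finite :=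
    ae_all_iff.2 fun m => hP.ae_finite (measurableSet_tent _) (intensity_tent_ne_top hd _)
  filter_upwards [h] with ω hω c
  obtain ⟨m, hm⟩ := exists_nat_ge c
  exact exists_nat_subset_closedBall
    ((hω m).subset (inter_subset_inter_right _ fun x hx => le_trans hx hm))

lemma IsPoissonProcess.ae_exists_spike_nonempty (hP : IsPoissonProcess μ (intensity d) P) :
    ∀ᵐ ω ∂μ, ∀ n : ℕ, ∃ m : ℕ, ∀ i,
      (P ω ∩ (spike i n ∩ Metric.closedBall 0 (m : ℝ))).Nonempty := by
  have h : ∀ᵐ ω ∂μ, ∀ (n : ℕ) (i : Fin d), (P ω ∩ spike i n).Nonempty :=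
    ae_all_iff.2 fun n => ae_all_iff.2 fun i => hP.ae_inter_spike_nonempty i n
  filter_upwards [h] with ω hω n
  choose x hx using hω n
  obtain ⟨m, hm⟩ := exists_nat_subset_closedBall (finite_range x)
  exact ⟨m, fun i => ⟨x i, (hx i).1, (hx i).2, hm ⟨i, rfl⟩⟩⟩

theorem convergesInProbabilityOver_Psi [IsProbabilityMeasure μ] (hd : 2 ≤ d)
    (hP : IsPoissonProcess μ (intensity d) P) {L : ℝ} (hL : 0 < L) :
    ConvergesInProbabilityOver μ L
      (fun lam ω => boundaryIn (window d lam) (Psi (window d lam) (P ω ∩ window d lam)))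
      (fun ω => frontier (Psi univ (P ω))) := by
  have hd0 : 0 < d := by omega
  choose N hN using exists_isGraphOver_Psi hd0 hL
  refine convergesInProbabilityOver_boundaryIn hd (ι := ℕ × ℕ) (fun a => N a.1 a.2)
    (A := fun a => {ω | (P ω ∩ Metric.closedBall 0 (a.1 : ℝ)).Nonempty} ∩
      {ω | P ω ∩ tent d (2 * a.1 + (L + 1) + 1 + Real.log d + (L + 1)) ⊆
        Metric.closedBall 0 (a.2 : ℝ)}) (fun a => ?_) ?_ fun a ω hω => hN a.1 a.2 _ hω.1 hω.2
  · exact (hP.measurableSet_inter_nonempty measurableSet_closedBall).inter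
      (hP.measurableSet_inter_subset (measurableSet_tent _) measurableSet_closedBall)
  · filter_upwards [hP.ae_exists_tent_subset_closedBall hd0, hP.ae_exists_spike_nonempty]
      with ω h1 h2
    -- Only some germ is needed here; a spike provides one.
    obtain ⟨k, hk⟩ := h2 0
    obtain ⟨n, hn⟩ := h1 (2 * k + (L + 1) + 1 + Real.log d + (L + 1))
    exact ⟨(k, n), (hk ⟨0, hd0⟩).mono (inter_subset_inter_right _ inter_subset_right), hn⟩

theorem convergesInProbabilityOver_Phi [IsProbabilityMeasure μ] (hd : 2 ≤ d)
    (hP : IsPoissonProcess μ (intensity d) P) {L : ℝ} (hL : 0 < L) :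
    ConvergesInProbabilityOver μ L
      (fun lam ω => boundaryIn (window d lam) (Phi (window d lam) (P ω ∩ window d lam)))
      (fun ω => frontier (Phi univ (P ω))) := by
  have hd0 : 0 < d := by omega
  choose n' R N hN using exists_isGraphOver_Phi hd0 hL
  refine convergesInProbabilityOver_boundaryIn hd (ι := ℕ × ℕ × ℕ)
    (fun a => N a.1 a.2.1 a.2.2)
    (A := fun a => {ω | P ω ∩ tent d (0 + Real.log d + (L + 1)) ⊆ Metric.closedBall 0 (a.1 : ℝ)} ∩
      ((⋂ i, {ω | (P ω ∩ (spike i (n' a.1) ∩ Metric.closedBall 0 (a.2.1 : ℝ))).Nonempty}) ∩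
      {ω | P ω ∩ tent d (R a.1 a.2.1 + Real.log d + R a.1 a.2.1) ⊆
        Metric.closedBall 0 (a.2.2 : ℝ)}))
    (fun a => ?_) ?_ fun a ω hω => hN a.1 a.2.1 a.2.2 _ hω.1 (mem_iInter.1 hω.2.1) hω.2.2
  · exact (hP.measurableSet_inter_subset (measurableSet_tent _) measurableSet_closedBall).inter
      ((MeasurableSet.iInter fun i => hP.measurableSet_inter_nonempty
        ((measurableSet_spike _ _).inter measurableSet_closedBall)).inter
      (hP.measurableSet_inter_subset (measurableSet_tent _) measurableSet_closedBall))
  · filter_upwards [hP.ae_exists_tent_subset_closedBall hd0, hP.ae_exists_spike_nonempty]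
      with ω h1 h2
    -- The radii are picked in order of dependence: n fixes the spikes, m then bounds the apices,
    -- and p bounds the germs that those apices can meet.
    obtain ⟨n, hn⟩ := h1 (0 + Real.log d + (L + 1))
    obtain ⟨m, hm⟩ := h2 (n' n)
    obtain ⟨p, hp⟩ := h1 (R n m + Real.log d + R n m)
    exact ⟨(n, m, p), hn, mem_iInter.2 hm, hp⟩

end Events

end GermGrain

theorem proposition6p1 {Ω : Type*} [MeasurableSpace Ω] (μ : Measure Ω) [IsProbabilityMeasure μ]
    (d : ℕ) (hd : 2 ≤ d) (P : Ω → Set (GermGrain.V d × ℝ))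
    (hP : GermGrain.IsPoissonProcess μ (GermGrain.intensity d) P) (L : ℝ) (hL : 0 < L) :
    GermGrain.ConvergesInProbabilityOver μ L
      (fun lam ω => GermGrain.boundaryIn (GermGrain.window d lam)
        (GermGrain.Psi (GermGrain.window d lam) (P ω ∩ GermGrain.window d lam)))
      (fun ω => frontier (GermGrain.Psi univ (P ω))) ∧
    GermGrain.ConvergesInProbabilityOver μ L
      (fun lam ω => GermGrain.boundaryIn (GermGrain.window d lam)
        (GermGrain.Phi (GermGrain.window d lam) (P ω ∩ GermGrain.window d lam)))
      (fun ω => frontier (GermGrain.Phi univ (P ω))) :=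
  ⟨GermGrain.convergesInProbabilityOver_Psi hd hP hL,
    GermGrain.convergesInProbabilityOver_Phi hd hP hL⟩
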